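/- Let $\mathcal{H}=\mathbb{C}^n$, and let $\Phi,\Psi$ be completely positive linear maps from $L(\mathcal{H})$ to $L(\mathcal{H})$ that are bi-stochastic, i.e. trace-preserving ($\operatorname{Tr}\Phi(X)=\operatorname{Tr}X$ for all $X$) and unit-preserving ($\Phi(\mathbb{1})=\mathbb{1}$), and likewise for $\Psi$. For a linear map $\Lambda$ on $L(\mathcal{H})$ let $$\rho(\Lambda)=\tfrac1n\,(\Lambda\otimes\mathrm{id})\bigl(|\mathbb{1}\rangle\rangle\langle\langle\mathbb{1}|\bigr),\qquad |\mathbb{1}\rangle\rangle=\sum_{i=1}^n|i\rangle\otimes|i\rangle ,$$ be its Jamiołkowski state and, when $\Lambda$ is completely positive and trace-preserving, let $S^{\mathrm{map}}(\Lambda)=S(\rho(\Lambda))$ be its map entropy, where $S(\rho)=-\operatorname{Tr}(\rho\log\rho)$ is the von Neumann entropy. Then $$\max\{S^{\mathrm{map}}(\Phi),\,S^{\mathrm{map}}(\Psi)\}\;\le\;S^{\mathrm{map}}(\Phi\circ\Psi)\;\le\;S^{\mathrm{map}}(\Phi)+S^{\mathrm{map}}(\Psi).$$ -/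

import Mathlib

open scoped CStarAlgebra MatrixOrder Matrix.Norms.L2Operator

namespace QuantumMap

noncomputable section

variable {ι κ : Type*}

/-- A super-operator: a linear map from operators to operators on `ℂ^ι`. -/
abbrev SuperOperator (ι : Type*) := Matrix ι ι ℂ →ₗ[ℂ] Matrix ι ι ℂ

/-- Bi-stochastic: trace-preserving and unit-preserving. -/
structure IsBistochastic [Fintype ι] [DecidableEq ι] (Φ : SuperOperator ι) : Prop where
  trace_preserving : ∀ X : Matrix ι ι ℂ, (Φ X).trace = X.trace
  unit_preserving : Φ 1 = 1

/-- The von Neumann entropy `S(ρ) = -Tr (ρ log ρ)` (natural logarithm, `0 log 0 = 0`), where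
`-ρ log ρ` is given by the functional calculus. -/
def vonNeumannEntropy [Fintype ι] [DecidableEq ι] (ρ : Matrix ι ι ℂ) : ℝ :=
  (cfc Real.negMulLog ρ).trace.re

/-- The entropy is the Shannon entropy of the eigenvalues. -/
theorem vonNeumannEntropy_eq_sum [Fintype ι] [DecidableEq ι] {ρ : Matrix ι ι ℂ} (hρ : ρ.IsHermitian) :
    vonNeumannEntropy ρ = ∑ i, Real.negMulLog (hρ.eigenvalues i) := by
  rw [vonNeumannEntropy, hρ.cfc_eq, Matrix.IsHermitian.cfc, Unitary.conjStarAlgAut_apply,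
    Matrix.trace_mul_cycle]
  simp [Matrix.trace_diagonal]

/-- The vectorization `|A⟫ = ∑ A_{mμ} |m μ⟩`. -/
def vec (A : Matrix ι κ ℂ) : ι × κ → ℂ := fun p => A p.1 p.2

/-- The rank-one operator `|v⟩⟨v|`. -/
def outer (v : ι → ℂ) : Matrix ι ι ℂ := Matrix.vecMulVec v (star v)

/-- The map `Φ ⊗ id` on operators on `ℂ^ι ⊗ ℂ^κ`: `Φ` is applied to every block of a matrix
whose block position is given by the second tensor factor. -/
def tensorId (κ : Type*) (Φ : SuperOperator ι) : SuperOperator (ι × κ) where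
  toFun X := Matrix.of fun p q => Φ (Matrix.of fun i j => X (i, p.2) (j, q.2)) p.1 q.1
  map_add' X Y := by
    ext p q
    exact congrFun (congrFun (map_add Φ (Matrix.of fun i j => X (i, p.2) (j, q.2))
      (Matrix.of fun i j => Y (i, p.2) (j, q.2))) p.1) q.1
  map_smul' c X := by
    ext p q
    exact congrFun (congrFun (map_smul Φ c (Matrix.of fun i j => X (i, p.2) (j, q.2))) p.1) q.1

/-- `tensorId` is indeed `Φ ⊗ id`. -/
theorem tensorId_kronecker (Φ : SuperOperator ι) (A : Matrix ι ι ℂ) (B : Matrix κ κ ℂ) :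
    tensorId κ Φ (Matrix.kronecker A B) = Matrix.kronecker (Φ A) B := by
  ext p q
  have h : (Matrix.of fun i j => Matrix.kronecker A B (i, p.2) (j, q.2)) = B p.2 q.2 • A := by
    ext i j
    simp [Matrix.kronecker, Matrix.kroneckerMap_apply, mul_comm]
  change Φ (Matrix.of fun i j => Matrix.kronecker A B (i, p.2) (j, q.2)) p.1 q.1 = _
  rw [h, map_smul]
  simp [Matrix.kronecker, Matrix.kroneckerMap_apply, mul_comm]

/-- The dynamical matrix `(Φ ⊗ id)(|1⟫⟪1|)`. -/
def dynamicalMatrix [DecidableEq ι] (Φ : SuperOperator ι) : Matrix (ι × ι) (ι × ι) ℂ :=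
  tensorId ι Φ (outer (vec (1 : Matrix ι ι ℂ)))

/-- The Jamiołkowski state `ρ(Φ)`: the dynamical matrix divided by the dimension `n = |ι|`. -/
def jamiolkowskiState [Fintype ι] [DecidableEq ι] (Φ : SuperOperator ι) : Matrix (ι × ι) (ι × ι) ℂ :=
  (Fintype.card ι : ℂ)⁻¹ • dynamicalMatrix Φ

/-- The map entropy `S^map(Φ) = S(ρ(Φ))`. -/
def mapEntropy [Fintype ι] [DecidableEq ι] (Φ : SuperOperator ι) : ℝ := vonNeumannEntropy (jamiolkowskiState Φ)

end

end QuantumMap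

/-!
A completely positive map has Kraus operators, `Φ X = ∑ A_k X A_k†`. Its Jamiołkowski state is
`n⁻¹ V V†`, where the columns of `V` are the vectors `|A_k⟫`, so it has the same nonzero spectrum
as the Gram matrix `n⁻¹ V† V` with entries `n⁻¹ Tr (A_k† A_l)`, and the map entropy is the entropy
of this Gram matrix (`mapEntropy_krausMap`). Preservation of the trace and of the unit become
`∑ A_k† A_k = 1` and `∑ A_k A_k† = 1`.

Entropies are compared through one consequence of Jensen's inequality
(`vonNeumannEntropy_le_sum_negMulLog_trace_mul`): if positive matrices `Q_j` of trace one sum to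
the identity, then `S(ρ)` is at most the Shannon entropy of the numbers `Tr (Q_j ρ)`, because these
are obtained from the eigenvalues of `ρ` by a doubly stochastic matrix.

* Lower bound. A bistochastic completely positive map does not decrease the entropy
  (`vonNeumannEntropy_le_kraus`): pull the eigenprojections of the output back to get the `Q_j`.
  Since `ρ(Φ ∘ Ψ) = (Φ ⊗ id) ρ(Ψ)`, this gives `S(Ψ) ≤ S(Φ ∘ Ψ)`. Replacing all Kraus
  operators by their adjoints transposes the Gram matrix, hence preserves the map entropy, and
  reverses the order of composition; this gives `S(Φ) ≤ S(Φ ∘ Ψ)`.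
* Upper bound. `Φ ∘ Ψ` has Kraus operators `A_k B_l`. Their Gram matrix lives on a tensor product,
  and its two partial traces are the Gram matrices of `A` and `B`, because `∑ B_l B_l† = 1` and
  `∑ A_k† A_k = 1`. The bound is thus the subadditivity of the entropy
  (`vonNeumannEntropy_le_add_partialTrace`), which follows from the Jensen bound with products of
  eigenprojections of the two partial traces, and from the subadditivity of the Shannon entropy.
-/

open scoped CStarAlgebra MatrixOrder Matrix.Norms.L2Operator ComplexOrder Kronecker

namespace QuantumMap

noncomputable section

/-! ### Von Neumann entropy and its growth under bistochastic maps -/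

section Entropy

variable {m k : Type*} [Fintype m] [DecidableEq m] [Fintype k]

theorem vonNeumannEntropy_eq_sum_roots {ρ : Matrix m m ℂ} (hρ : ρ.IsHermitian) :
    vonNeumannEntropy ρ = (ρ.charpoly.roots.map fun z => Real.negMulLog z.re).sum := by
  rw [vonNeumannEntropy_eq_sum hρ, hρ.roots_charpoly_eq_eigenvalues, Multiset.map_map]
  simp

theorem vonNeumannEntropy_transpose {ρ : Matrix m m ℂ} (hρ : ρ.IsHermitian) :
    vonNeumannEntropy ρ.transpose = vonNeumannEntropy ρ := by
  rw [vonNeumannEntropy_eq_sum_roots hρ, vonNeumannEntropy_eq_sum_roots hρ.transpose,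
    Matrix.charpoly_transpose]

/-- `AB` and `BA` have the same nonzero eigenvalues, and zero eigenvalues do not contribute to the
entropy. -/
theorem vonNeumannEntropy_mul_comm [DecidableEq k] (A : Matrix m k ℂ) (B : Matrix k m ℂ)
    (hAB : (A * B).IsHermitian) (hBA : (B * A).IsHermitian) :
    vonNeumannEntropy (A * B) = vonNeumannEntropy (B * A) := by
  rw [vonNeumannEntropy_eq_sum_roots hAB, vonNeumannEntropy_eq_sum_roots hBA]
  have h := congrArg (fun p => (p.roots.map fun z : ℂ => Real.negMulLog z.re).sum)
    (Matrix.charpoly_mul_comm' A B)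
  have hX : ∀ j : ℕ, (Polynomial.X ^ j : Polynomial ℂ) ≠ 0 := fun j =>
    pow_ne_zero _ Polynomial.X_ne_zero
  simpa [Polynomial.roots_mul, (Matrix.charpoly_monic _).ne_zero, hX,
    Multiset.map_nsmul, Multiset.sum_nsmul] using h

theorem posSemidef_trace_mul_re_nonneg {A B : Matrix m m ℂ} (hA : A.PosSemidef)
    (hB : B.PosSemidef) : 0 ≤ (A * B).trace.re := by
  obtain ⟨C, rfl⟩ := CStarAlgebra.nonneg_iff_eq_star_mul_self.mp hB.nonneg
  rw [← Matrix.mul_assoc, Matrix.trace_mul_comm, ← Matrix.mul_assoc]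
  exact (Complex.nonneg_iff.mp (hA.mul_mul_conjTranspose_same C).trace_nonneg).1

/-- The orthogonal projection onto the line spanned by the `i`-th vector of Mathlib's eigenbasis of
a Hermitian matrix (not onto the whole eigenspace when the eigenvalue is degenerate). -/
def eigenprojection {ρ : Matrix m m ℂ} (hρ : ρ.IsHermitian) (i : m) : Matrix m m ℂ :=
  (hρ.eigenvectorUnitary : Matrix m m ℂ) * Matrix.single i i 1 *
    (hρ.eigenvectorUnitary : Matrix m m ℂ).conjTranspose

section Eigenprojection

variable {ρ : Matrix m m ℂ} (hρ : ρ.IsHermitian)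

theorem posSemidef_eigenprojection (i : m) : (eigenprojection hρ i).PosSemidef := by
  refine Matrix.PosSemidef.mul_mul_conjTranspose_same ?_ _
  rw [← Matrix.diagonal_single]
  refine Matrix.PosSemidef.diagonal (Pi.single_nonneg.mpr zero_le_one)

theorem eigenvectorUnitary_mul_conjTranspose :
    (hρ.eigenvectorUnitary : Matrix m m ℂ) *
      (hρ.eigenvectorUnitary : Matrix m m ℂ).conjTranspose = 1 :=
  Unitary.coe_mul_star_self hρ.eigenvectorUnitary

theorem conjTranspose_mul_eigenvectorUnitary :
    (hρ.eigenvectorUnitary : Matrix m m ℂ).conjTranspose *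
      (hρ.eigenvectorUnitary : Matrix m m ℂ) = 1 :=
  Unitary.coe_star_mul_self hρ.eigenvectorUnitary

theorem sum_eigenprojection : ∑ i, eigenprojection hρ i = 1 := by
  simp only [eigenprojection]
  rw [← Finset.sum_mul, ← Finset.mul_sum, Matrix.sum_single_one, mul_one,
    eigenvectorUnitary_mul_conjTranspose]

theorem trace_eigenprojection (i : m) : (eigenprojection hρ i).trace = 1 := by
  rw [eigenprojection, Matrix.trace_mul_cycle, conjTranspose_mul_eigenvectorUnitary, one_mul,
    Matrix.trace_single_eq_same]

theorem eq_sum_eigenvalues_smul_eigenprojection :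
    ρ = ∑ i, (hρ.eigenvalues i : ℂ) • eigenprojection hρ i := by
  conv_lhs =>
    rw [hρ.spectral_theorem, Unitary.conjStarAlgAut_apply, ← Matrix.sum_single_eq_diagonal]
  simp only [eigenprojection, Finset.mul_sum, Finset.sum_mul]
  refine Finset.sum_congr rfl fun i _ => ?_
  rw [← Matrix.smul_mul, ← Matrix.mul_smul, Matrix.smul_single, smul_eq_mul, mul_one]
  rfl

theorem trace_eigenprojection_mul (i : m) :
    (eigenprojection hρ i * ρ).trace = hρ.eigenvalues i := by
  calc (eigenprojection hρ i * ρ).trace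
      = (Matrix.single i i 1 * ((hρ.eigenvectorUnitary : Matrix m m ℂ).conjTranspose * ρ *
          (hρ.eigenvectorUnitary : Matrix m m ℂ))).trace := by
        rw [eigenprojection, Matrix.mul_assoc, Matrix.mul_assoc, Matrix.trace_mul_comm,
          Matrix.mul_assoc]
    _ = hρ.eigenvalues i := by
        have h := hρ.conjStarAlgAut_star_eigenvectorUnitary
        rw [Unitary.conjStarAlgAut_star_apply, Matrix.star_eq_conjTranspose] at h
        rw [h]
        simp [Matrix.trace_single_mul]

end Eigenprojection

/-- Let `P_i` be the eigenprojections of `ρ`. The numbers `Tr (Q_j P_i)` form a doubly stochastic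
matrix, and Jensen's inequality for the concave function `-x log x` applies to each row. -/
theorem vonNeumannEntropy_le_sum_negMulLog_trace_mul {ρ : Matrix m m ℂ} (hρ : ρ.PosSemidef)
    {Q : k → Matrix m m ℂ} (hQ : ∀ j, (Q j).PosSemidef) (hsum : ∑ j, Q j = 1)
    (htr : ∀ j, (Q j).trace = 1) :
    vonNeumannEntropy ρ ≤ ∑ j, Real.negMulLog (Q j * ρ).trace.re := by
  set P := eigenprojection hρ.isHermitian
  set l := hρ.isHermitian.eigenvalues
  have hval : ∀ j, (Q j * ρ).trace.re = ∑ i, (Q j * P i).trace.re * l i := by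
    intro j
    conv_lhs => rw [eq_sum_eigenvalues_smul_eigenprojection hρ.isHermitian]
    simp [Finset.mul_sum, Matrix.trace_sum, P, l, mul_comm]
  have hcol : ∀ i, ∑ j, (Q j * P i).trace.re = 1 := by
    intro i
    rw [← Complex.re_sum, ← Matrix.trace_sum, ← Finset.sum_mul, hsum, one_mul,
      trace_eigenprojection, Complex.one_re]
  have hrow : ∀ j, ∑ i, (Q j * P i).trace.re = 1 := by
    intro j
    rw [← Complex.re_sum, ← Matrix.trace_sum, ← Finset.mul_sum, sum_eigenprojection, mul_one,
      htr, Complex.one_re]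
  have hnn : ∀ j i, 0 ≤ (Q j * P i).trace.re := fun j i =>
    posSemidef_trace_mul_re_nonneg (hQ j) (posSemidef_eigenprojection _ i)
  calc vonNeumannEntropy ρ = ∑ i, Real.negMulLog (l i) := vonNeumannEntropy_eq_sum _
    _ = ∑ i, ∑ j, (Q j * P i).trace.re * Real.negMulLog (l i) := by
      simp only [← Finset.sum_mul, hcol, one_mul]
    _ = ∑ j, ∑ i, (Q j * P i).trace.re * Real.negMulLog (l i) := Finset.sum_comm
    _ ≤ ∑ j, Real.negMulLog (Q j * ρ).trace.re := by
      refine Finset.sum_le_sum fun j _ => ?_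
      rw [hval]
      exact Real.concaveOn_negMulLog.le_map_sum (fun i _ => hnn j i) (hrow j)
        (fun i _ => hρ.eigenvalues_nonneg i)

/-- A trace-preserving and unital completely positive map does not decrease the entropy. -/
theorem vonNeumannEntropy_le_kraus {ρ : Matrix m m ℂ} (hρ : ρ.PosSemidef)
    {A : k → Matrix m m ℂ} (hunit : ∑ j, A j * (A j).conjTranspose = 1)
    (htr : ∑ j, (A j).conjTranspose * A j = 1) :
    vonNeumannEntropy ρ ≤ vonNeumannEntropy (∑ j, A j * ρ * (A j).conjTranspose) := by
  have hσ : (∑ j, A j * ρ * (A j).conjTranspose).PosSemidef :=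
    Matrix.posSemidef_sum _ fun j _ => hρ.mul_mul_conjTranspose_same _
  set σ := ∑ j, A j * ρ * (A j).conjTranspose
  set P := eigenprojection hσ.isHermitian
  -- Duality: the trace pairing of the pulled back projection with `X`.
  have key : ∀ (X : Matrix m m ℂ) i, ((∑ j, (A j).conjTranspose * P i * A j) * X).trace =
      (P i * ∑ j, A j * X * (A j).conjTranspose).trace := by
    intro X i
    simp only [Finset.sum_mul, Finset.mul_sum, Matrix.trace_sum]
    refine Finset.sum_congr rfl fun j _ => ?_
    rw [Matrix.mul_assoc, Matrix.mul_assoc, Matrix.trace_mul_comm]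
    simp only [Matrix.mul_assoc]
  refine (vonNeumannEntropy_le_sum_negMulLog_trace_mul hρ
    (Q := fun i => ∑ j, (A j).conjTranspose * P i * A j) (fun i => ?_) ?_ fun i => ?_).trans_eq ?_
  · exact Matrix.posSemidef_sum _ fun j _ =>
      (posSemidef_eigenprojection _ i).conjTranspose_mul_mul_same _
  · rw [Finset.sum_comm]
    simp only [← Finset.sum_mul, ← Finset.mul_sum, P, sum_eigenprojection, mul_one, htr]
  · have := key 1 i
    simpa [hunit, P, trace_eigenprojection] using this
  · rw [vonNeumannEntropy_eq_sum hσ.isHermitian]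
    refine Finset.sum_congr rfl fun i _ => ?_
    rw [key, trace_eigenprojection_mul, Complex.ofReal_re]

end Entropy

/-! ### Subadditivity -/

section Subadditivity

variable {m k : Type*}

/-- The partial trace over the second tensor factor. -/
def partialTraceRight [Fintype k] (ρ : Matrix (m × k) (m × k) ℂ) : Matrix m m ℂ :=
  Matrix.of fun i j => ∑ a, ρ (i, a) (j, a)

/-- The partial trace over the first tensor factor. -/
def partialTraceLeft [Fintype m] (ρ : Matrix (m × k) (m × k) ℂ) : Matrix k k ℂ :=
  Matrix.of fun a b => ∑ i, ρ (i, a) (i, b)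

theorem trace_kronecker_one_mul [Fintype m] [Fintype k] [DecidableEq k] (X : Matrix m m ℂ)
    (ρ : Matrix (m × k) (m × k) ℂ) :
    ((X ⊗ₖ (1 : Matrix k k ℂ)) * ρ).trace = (X * partialTraceRight ρ).trace := by
  simp only [Matrix.trace, Matrix.diag, Matrix.mul_apply, Fintype.sum_prod_type,
    Matrix.kronecker_apply, Matrix.one_apply, partialTraceRight, Matrix.of_apply, Finset.mul_sum]
  refine Finset.sum_congr rfl fun i _ => ?_
  rw [Finset.sum_comm]
  simp

theorem trace_one_kronecker_mul [Fintype m] [DecidableEq m] [Fintype k] (X : Matrix k k ℂ)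
    (ρ : Matrix (m × k) (m × k) ℂ) :
    (((1 : Matrix m m ℂ) ⊗ₖ X) * ρ).trace = (X * partialTraceLeft ρ).trace := by
  simp only [Matrix.trace, Matrix.diag, Matrix.mul_apply, Fintype.sum_prod_type,
    Matrix.kronecker_apply, Matrix.one_apply, partialTraceLeft, Matrix.of_apply, Finset.mul_sum]
  rw [Finset.sum_comm]
  refine Finset.sum_congr rfl fun i _ => ?_
  simp
  rw [Finset.sum_comm]

theorem isHermitian_partialTraceRight [Fintype k] {ρ : Matrix (m × k) (m × k) ℂ}
    (hρ : ρ.IsHermitian) :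
    (partialTraceRight ρ).IsHermitian := by
  ext i j
  simp only [Matrix.conjTranspose_apply, partialTraceRight, Matrix.of_apply, star_sum]
  exact Finset.sum_congr rfl fun a _ => hρ.apply _ _

theorem isHermitian_partialTraceLeft [Fintype m] {ρ : Matrix (m × k) (m × k) ℂ}
    (hρ : ρ.IsHermitian) :
    (partialTraceLeft ρ).IsHermitian := by
  ext i j
  simp only [Matrix.conjTranspose_apply, partialTraceLeft, Matrix.of_apply, star_sum]
  exact Finset.sum_congr rfl fun a _ => hρ.apply _ _

/-- The pointwise form of Gibbs' inequality, `p log (ab / p) ≤ ab - p`. The bounds `p ≤ a` and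
`p ≤ b` ensure that `p = 0` wherever `log a` or `log b` takes the junk value `0`. -/
theorem negMulLog_le_of_joint {p a b : ℝ} (hp : 0 ≤ p) (hpa : p ≤ a) (hpb : p ≤ b) :
    Real.negMulLog p ≤ -(p * Real.log a) - p * Real.log b + (a * b - p) := by
  rcases hp.eq_or_lt with rfl | hp
  · simpa using mul_nonneg hpa hpb
  have ha := hp.trans_le hpa
  have hb := hp.trans_le hpb
  have h := Real.log_le_sub_one_of_pos (x := a * b / p) (by positivity)
  rw [Real.log_div (by positivity) hp.ne', Real.log_mul ha.ne' hb.ne'] at h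
  have h2 := mul_le_mul_of_nonneg_left h hp.le
  have h3 : p * (a * b / p - 1) = a * b - p := by field_simp
  rw [h3] at h2
  rw [Real.negMulLog]
  linarith

/-- Subadditivity of the Shannon entropy of a joint distribution. -/
theorem sum_negMulLog_joint_le [Fintype m] [Fintype k] (p : m → k → ℝ)
    (hp : ∀ i j, 0 ≤ p i j)
    (h1 : ∑ i, ∑ j, p i j = 1) :
    ∑ i, ∑ j, Real.negMulLog (p i j) ≤
      ∑ i, Real.negMulLog (∑ j, p i j) + ∑ j, Real.negMulLog (∑ i, p i j) := by
  obtain ⟨a, ha⟩ : ∃ a : m → ℝ, ∀ i, ∑ j, p i j = a i := ⟨_, fun _ => rfl⟩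
  obtain ⟨b, hb⟩ : ∃ b : k → ℝ, ∀ j, ∑ i, p i j = b j := ⟨_, fun _ => rfl⟩
  have ha1 : ∑ i, a i = 1 := by simpa only [ha] using h1
  have hb1 : ∑ j, b j = 1 := by
    rw [Finset.sum_comm] at h1
    simpa only [hb] using h1
  have key : ∀ i j, Real.negMulLog (p i j) ≤
      -(p i j * Real.log (a i)) - p i j * Real.log (b j) + (a i * b j - p i j) := fun i j =>
    negMulLog_le_of_joint (hp i j)
      (ha i ▸ Finset.single_le_sum (fun j _ => hp i j) (Finset.mem_univ j))
      (hb j ▸ Finset.single_le_sum (f := fun i => p i j) (fun i _ => hp i j) (Finset.mem_univ i))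
  refine (Finset.sum_le_sum fun i _ => Finset.sum_le_sum fun j _ => key i j).trans_eq ?_
  have e1 : ∑ i, ∑ j, p i j * Real.log (a i) = ∑ i, a i * Real.log (a i) := by
    simp only [← Finset.sum_mul, ha]
  have e2 : ∑ i, ∑ j, p i j * Real.log (b j) = ∑ j, b j * Real.log (b j) := by
    rw [Finset.sum_comm]
    simp only [← Finset.sum_mul, hb]
  have e3 : ∑ i, ∑ j, a i * b j = 1 := by
    rw [← Finset.sum_mul_sum, hb1, mul_one, ha1]
  simp only [Finset.sum_add_distrib, Finset.sum_sub_distrib, Finset.sum_neg_distrib, e1, e2, e3, ha,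
    ha1, hb, Real.negMulLog, neg_mul, sub_self, add_zero, ← sub_eq_add_neg]

/-- Subadditivity of the von Neumann entropy. Measuring `ρ` in the product of the eigenbases of its
partial traces gives a joint distribution whose marginals are their spectra. -/
theorem vonNeumannEntropy_le_add_partialTrace [Fintype m] [DecidableEq m] [Fintype k]
    [DecidableEq k] {ρ : Matrix (m × k) (m × k) ℂ} (hρ : ρ.PosSemidef)
    (htr : ρ.trace = 1) :
    vonNeumannEntropy ρ ≤
      vonNeumannEntropy (partialTraceRight ρ) + vonNeumannEntropy (partialTraceLeft ρ) := by
  have hR := isHermitian_partialTraceRight hρ.isHermitian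
  have hL := isHermitian_partialTraceLeft hρ.isHermitian
  set P := eigenprojection hR with hP
  set R := eigenprojection hL with hR'
  have sumR : ∀ X : Matrix m m ℂ, ∑ j, X ⊗ₖ R j = X ⊗ₖ (1 : Matrix k k ℂ) := by
    intro X
    rw [← sum_eigenprojection hL]
    ext ⟨i, a⟩ ⟨j, b⟩
    simp [Matrix.sum_apply, Finset.mul_sum, R]
  have sumP : ∀ X : Matrix k k ℂ, ∑ i, P i ⊗ₖ X = (1 : Matrix m m ℂ) ⊗ₖ X := by
    intro X
    rw [← sum_eigenprojection hR]
    ext ⟨i, a⟩ ⟨j, b⟩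
    simp [Matrix.sum_apply, Finset.sum_mul, P]
  have hPR : ∀ i j, (P i ⊗ₖ R j).PosSemidef := fun i j =>
    (posSemidef_eigenprojection hR i).kronecker (posSemidef_eigenprojection hL j)
  have margR : ∀ i, ∑ j, ((P i ⊗ₖ R j) * ρ).trace.re = hR.eigenvalues i := by
    intro i
    rw [← Complex.re_sum, ← Matrix.trace_sum, ← Finset.sum_mul, sumR, trace_kronecker_one_mul,
      trace_eigenprojection_mul, Complex.ofReal_re]
  have margL : ∀ j, ∑ i, ((P i ⊗ₖ R j) * ρ).trace.re = hL.eigenvalues j := by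
    intro j
    rw [← Complex.re_sum, ← Matrix.trace_sum, ← Finset.sum_mul, sumP, trace_one_kronecker_mul,
      trace_eigenprojection_mul, Complex.ofReal_re]
  have htot : ∑ i, ∑ j, ((P i ⊗ₖ R j) * ρ).trace.re = 1 := by
    simp only [← Complex.re_sum, ← Matrix.trace_sum, ← Finset.sum_mul, sumR, sumP]
    rw [Matrix.one_kronecker_one, one_mul, htr, Complex.one_re]
  calc vonNeumannEntropy ρ
      ≤ ∑ q : m × k, Real.negMulLog ((P q.1 ⊗ₖ R q.2) * ρ).trace.re := by
        refine vonNeumannEntropy_le_sum_negMulLog_trace_mul hρ (fun q => hPR _ _) ?_ fun q => ?_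
        · rw [Fintype.sum_prod_type]
          simp only [sumR, sumP, Matrix.one_kronecker_one]
        · rw [Matrix.trace_kronecker, trace_eigenprojection, trace_eigenprojection, one_mul]
    _ = ∑ i, ∑ j, Real.negMulLog ((P i ⊗ₖ R j) * ρ).trace.re := Fintype.sum_prod_type _
    _ ≤ _ := sum_negMulLog_joint_le _
        (fun i j => posSemidef_trace_mul_re_nonneg (hPR i j) hρ) htot
    _ = _ := by
      simp only [margR, margL]
      rw [vonNeumannEntropy_eq_sum hR, vonNeumannEntropy_eq_sum hL]

end Subadditivity

/-! ### Kraus operators -/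

section Kraus

variable {ι κ κ' : Type*} [Fintype ι]

section

variable [Fintype κ] [Fintype κ']

/-- The completely positive map `X ↦ ∑ A_k X A_k†` with Kraus operators `A_k`. -/
def krausMap (A : κ → Matrix ι ι ℂ) : SuperOperator ι where
  toFun X := ∑ k, A k * X * (A k).conjTranspose
  map_add' X Y := by simp [Matrix.mul_add, Matrix.add_mul, Finset.sum_add_distrib]
  map_smul' c X := by simp [Finset.smul_sum]

theorem krausMap_apply (A : κ → Matrix ι ι ℂ) (X : Matrix ι ι ℂ) :
    krausMap A X = ∑ k, A k * X * (A k).conjTranspose := rfl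

theorem krausMap_comp (A : κ → Matrix ι ι ℂ) (B : κ' → Matrix ι ι ℂ) :
    krausMap A ∘ₗ krausMap B = krausMap fun q : κ × κ' => A q.1 * B q.2 := by
  ext1 X
  simp only [LinearMap.comp_apply, krausMap_apply, Fintype.sum_prod_type, Finset.mul_sum,
    Finset.sum_mul, Matrix.conjTranspose_mul, Matrix.mul_assoc]

theorem krausMap_comp_equiv (e : κ' ≃ κ) (A : κ → Matrix ι ι ℂ) :
    krausMap (A ∘ e) = krausMap A := by
  ext1 X
  exact e.sum_comp fun k => A k * X * (A k).conjTranspose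

/-- Stated for an abstract C⋆-algebra because the functional calculus instances needed by
`CStarAlgebra.nonneg_iff_eq_star_mul_self` are not found by instance search on
`CStarMatrix`. -/
theorem exists_eq_star_mul_self_of_nonneg {A : Type*} [NonUnitalCStarAlgebra A] [PartialOrder A]
    [StarOrderedRing A] {a : A} (ha : 0 ≤ a) : ∃ b, a = star b * b :=
  CStarAlgebra.nonneg_iff_eq_star_mul_self.mp ha

/-- Choi's theorem. The block matrix `(Φ(E_ij))_ij` is positive, hence of the form `M† M`, and the
entries of the blocks of `M` are the conjugates of the entries of the Kraus operators. -/
theorem exists_eq_krausMap [DecidableEq ι] (Φ : Matrix ι ι ℂ →CP Matrix ι ι ℂ) :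
    ∃ A : ι × ι → Matrix ι ι ℂ, Φ.toLinearMap = krausMap A := by
  cases isEmpty_or_nonempty ι
  · exact ⟨0, LinearMap.ext fun X => Subsingleton.elim _ _⟩
  obtain ⟨i₀⟩ := ‹Nonempty ι›
  -- Only row `i₀` of `N` is nonzero, and its blocks are the matrix units `E_{i₀ i}`, so that the
  -- blocks of `N† N` are the matrix units `E_ij`.
  let N : CStarMatrix ι ι (Matrix ι ι ℂ) :=
    CStarMatrix.ofMatrix (Matrix.of fun a i => if a = i₀ then Matrix.single i₀ i 1 else 0)
  have hN : ∀ i j, (star N * N) i j = Matrix.single i j 1 := by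
    intro i j
    rw [CStarMatrix.mul_apply, Finset.sum_eq_single i₀]
    · simp [N, CStarMatrix.star_apply, Matrix.star_eq_conjTranspose]
    · intro b _ hb
      simp [N, hb]
    · simp
  have h := Φ.map_cstarMatrix_nonneg _ (star_mul_self_nonneg N)
  obtain ⟨M, hM⟩ := exists_eq_star_mul_self_of_nonneg h
  have hΦ : ∀ i j, Φ.toLinearMap (Matrix.single i j 1) = ∑ a, (M a i).conjTranspose * M a j := by
    intro i j
    have := congrFun (congrFun hM i) j
    rw [CStarMatrix.map_apply, hN, CStarMatrix.mul_apply] at this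
    exact this
  refine ⟨fun q => Matrix.of fun x i => star (M q.1 i q.2 x), ?_⟩
  refine Matrix.ext_linearMap _ fun i j => LinearMap.ext_ring ?_
  simp only [LinearMap.comp_apply, Matrix.singleLinearMap_apply]
  rw [hΦ, krausMap_apply, Fintype.sum_prod_type]
  refine Finset.sum_congr rfl fun a _ => ?_
  ext x y
  simp [Matrix.sum_apply, Matrix.mul_apply, Matrix.single_apply, ite_and]

theorem tensorId_krausMap [DecidableEq κ'] (A : κ → Matrix ι ι ℂ) :
    tensorId κ' (krausMap A) = krausMap fun k => A k ⊗ₖ (1 : Matrix κ' κ' ℂ) := by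
  ext1 X
  ext ⟨i, a⟩ ⟨j, b⟩
  change krausMap A (Matrix.of fun x y => X (x, a) (y, b)) i j = _
  simp [krausMap_apply, Matrix.sum_apply, Matrix.mul_apply, Fintype.sum_prod_type,
    Matrix.one_apply, apply_ite]

theorem sum_conjTranspose_mul_self_of_trace_preserving [DecidableEq ι] {A : κ → Matrix ι ι ℂ}
    (h : ∀ X, (krausMap A X).trace = X.trace) : ∑ k, (A k).conjTranspose * A k = 1 := by
  refine Matrix.ext_iff_trace_mul_right.mpr fun X => ?_
  rw [one_mul, ← h X, krausMap_apply, Finset.sum_mul, Matrix.trace_sum, Matrix.trace_sum]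
  exact Finset.sum_congr rfl fun k _ => by rw [Matrix.trace_mul_cycle, Matrix.trace_mul_cycle]

theorem sum_mul_conjTranspose_self_of_unital [DecidableEq ι] {A : κ → Matrix ι ι ℂ}
    (h : krausMap A 1 = 1) : ∑ k, A k * (A k).conjTranspose = 1 := by
  simpa [krausMap_apply] using h

end

/-- The matrix whose columns are the vectorized Kraus operators. -/
def krausVec (A : κ → Matrix ι ι ℂ) : Matrix (ι × ι) κ ℂ := Matrix.of fun p k => vec (A k) p

/-- The normalized Gram matrix `n⁻¹ Tr (A_k† A_l)` of a family of Kraus operators. Up to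
transposition it is the final state of the environment when the input is maximally mixed. -/
def krausGram (A : κ → Matrix ι ι ℂ) : Matrix κ κ ℂ :=
  Matrix.of fun k l => (Fintype.card ι : ℂ)⁻¹ * ((A k).conjTranspose * A l).trace

theorem krausGram_eq (A : κ → Matrix ι ι ℂ) :
    krausGram A = (Fintype.card ι : ℂ)⁻¹ • ((krausVec A).conjTranspose * krausVec A) := by
  ext k l
  simp [krausGram, krausVec, vec, Matrix.mul_apply, Matrix.trace, Fintype.sum_prod_type]
  left
  exact Finset.sum_comm

theorem posSemidef_krausGram [Finite κ] (A : κ → Matrix ι ι ℂ) : (krausGram A).PosSemidef := by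
  rw [krausGram_eq]
  exact (Matrix.posSemidef_conjTranspose_mul_self _).smul (by positivity)

theorem krausGram_conjTranspose (A : κ → Matrix ι ι ℂ) :
    krausGram (fun k => (A k).conjTranspose) = (krausGram A).transpose := by
  ext k l
  simp [krausGram, Matrix.trace_mul_comm (A k)]

/-! ### Map entropy -/

variable [Fintype κ] [Fintype κ'] [DecidableEq ι]

theorem dynamicalMatrix_krausMap (A : κ → Matrix ι ι ℂ) :
    dynamicalMatrix (krausMap A) = krausVec A * (krausVec A).conjTranspose := by
  ext ⟨i, a⟩ ⟨j, b⟩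
  have h : (Matrix.of fun x y => outer (vec (1 : Matrix ι ι ℂ)) (x, a) (y, b)) =
      Matrix.single a b 1 := by
    ext x y
    simp [outer, vec, Matrix.vecMulVec_apply, Matrix.one_apply, Matrix.single_apply, eq_comm,
      ← ite_and, and_comm]
  change krausMap A (Matrix.of fun x y => outer (vec (1 : Matrix ι ι ℂ)) (x, a) (y, b)) i j = _
  rw [h, krausMap_apply, Matrix.sum_apply, Matrix.mul_apply]
  refine Finset.sum_congr rfl fun k _ => ?_
  simp [krausVec, vec, Matrix.mul_apply, Matrix.single_apply, ite_and]

theorem posSemidef_jamiolkowskiState_krausMap (A : κ → Matrix ι ι ℂ) :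
    (jamiolkowskiState (krausMap A)).PosSemidef := by
  rw [jamiolkowskiState, dynamicalMatrix_krausMap]
  exact (Matrix.posSemidef_self_mul_conjTranspose _).smul (by positivity)

theorem jamiolkowskiState_comp (Φ Ψ : SuperOperator ι) :
    jamiolkowskiState (Φ ∘ₗ Ψ) = tensorId ι Φ (jamiolkowskiState Ψ) := by
  rw [jamiolkowskiState, jamiolkowskiState, map_smul]
  rfl

/-- The Jamiołkowski state and the Gram matrix are `n⁻¹ V V†` and `n⁻¹ V† V` for the same `V`. -/
theorem mapEntropy_krausMap [DecidableEq κ] (A : κ → Matrix ι ι ℂ) :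
    mapEntropy (krausMap A) = vonNeumannEntropy (krausGram A) := by
  have h1 := (posSemidef_jamiolkowskiState_krausMap A).isHermitian
  have h2 := (posSemidef_krausGram A).isHermitian
  rw [krausGram_eq, ← Matrix.mul_smul] at h2
  rw [jamiolkowskiState, dynamicalMatrix_krausMap, ← Matrix.smul_mul] at h1
  rw [mapEntropy, jamiolkowskiState, dynamicalMatrix_krausMap, krausGram_eq, ← Matrix.smul_mul,
    ← Matrix.mul_smul]
  exact vonNeumannEntropy_mul_comm _ _ h1 h2

/-- A map and its Hilbert–Schmidt adjoint have the same map entropy. -/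
theorem mapEntropy_krausMap_conjTranspose (A : κ → Matrix ι ι ℂ) :
    mapEntropy (krausMap fun k => (A k).conjTranspose) = mapEntropy (krausMap A) := by
  classical
  rw [mapEntropy_krausMap, mapEntropy_krausMap, krausGram_conjTranspose,
    vonNeumannEntropy_transpose (posSemidef_krausGram A).isHermitian]

/-- The Jamiołkowski state of the composition is the image of that of `krausMap B` under the
bistochastic map with Kraus operators `A_k ⊗ 1`. -/
theorem mapEntropy_le_comp_krausMap {A : κ → Matrix ι ι ℂ} (B : κ' → Matrix ι ι ℂ)
    (hunit : ∑ k, A k * (A k).conjTranspose = 1) (htr : ∑ k, (A k).conjTranspose * A k = 1) :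
    mapEntropy (krausMap B) ≤ mapEntropy (krausMap A ∘ₗ krausMap B) := by
  classical
  have hsum : ∀ X : κ → Matrix ι ι ℂ, ∑ k, X k = 1 →
      ∑ k, X k ⊗ₖ (1 : Matrix ι ι ℂ) = 1 := by
    intro X hX
    rw [← Matrix.one_kronecker_one, ← hX]
    ext ⟨i, a⟩ ⟨j, b⟩
    simp [Matrix.sum_apply, Finset.sum_mul]
  rw [mapEntropy, mapEntropy, jamiolkowskiState_comp, tensorId_krausMap, krausMap_apply]
  apply vonNeumannEntropy_le_kraus (posSemidef_jamiolkowskiState_krausMap B)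
  · simpa [Matrix.conjTranspose_kronecker, ← Matrix.mul_kronecker_mul] using hsum _ hunit
  · simpa [Matrix.conjTranspose_kronecker, ← Matrix.mul_kronecker_mul] using hsum _ htr

/-- Deduced from `mapEntropy_le_comp_krausMap` by taking adjoints, which reverse compositions. -/
theorem mapEntropy_le_krausMap_comp (A : κ → Matrix ι ι ℂ) {B : κ' → Matrix ι ι ℂ}
    (hunit : ∑ k, B k * (B k).conjTranspose = 1) (htr : ∑ k, (B k).conjTranspose * B k = 1) :
    mapEntropy (krausMap A) ≤ mapEntropy (krausMap A ∘ₗ krausMap B) := by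
  calc mapEntropy (krausMap A)
      = mapEntropy (krausMap fun k => (A k).conjTranspose) :=
        (mapEntropy_krausMap_conjTranspose A).symm
    _ ≤ mapEntropy ((krausMap fun l => (B l).conjTranspose) ∘ₗ
          krausMap fun k => (A k).conjTranspose) :=
        mapEntropy_le_comp_krausMap _ (by simpa using htr) (by simpa using hunit)
    _ = mapEntropy (krausMap A ∘ₗ krausMap B) := by
        rw [krausMap_comp, krausMap_comp, ← mapEntropy_krausMap_conjTranspose,
          ← krausMap_comp_equiv (Equiv.prodComm κ' κ)]
        simp [Function.comp_def]

theorem mapEntropy_comp_krausMap_le {A : κ → Matrix ι ι ℂ} {B : κ' → Matrix ι ι ℂ}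
    (hA : ∑ k, (A k).conjTranspose * A k = 1) (hB : ∑ l, B l * (B l).conjTranspose = 1) :
    mapEntropy (krausMap A ∘ₗ krausMap B) ≤ mapEntropy (krausMap A) + mapEntropy (krausMap B) := by
  classical
  cases isEmpty_or_nonempty ι
  -- In dimension zero the states have trace `0` instead of `1`, but all entropies vanish.
  · simp [mapEntropy, vonNeumannEntropy, Matrix.trace]
  -- Tracing out `B` uses `∑ B_l B_l† = 1`, tracing out `A` uses `∑ A_k† A_k = 1`.
  have hR : partialTraceRight (krausGram fun q : κ × κ' => A q.1 * B q.2) = krausGram A := by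
    ext k l
    simp only [partialTraceRight, krausGram, Matrix.of_apply, ← Finset.mul_sum, ← Matrix.trace_sum]
    congr 1
    calc _ = ∑ a, (((A k).conjTranspose * A l) * (B a * (B a).conjTranspose)).trace := by
          rw [Matrix.trace_sum]
          refine Finset.sum_congr rfl fun a _ => ?_
          rw [Matrix.conjTranspose_mul, Matrix.mul_assoc, Matrix.trace_mul_comm]
          simp only [Matrix.mul_assoc]
      _ = _ := by rw [← Matrix.trace_sum, ← Finset.mul_sum, hB, mul_one]
  have hL : partialTraceLeft (krausGram fun q : κ × κ' => A q.1 * B q.2) = krausGram B := by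
    ext k l
    simp only [partialTraceLeft, krausGram, Matrix.of_apply, ← Finset.mul_sum, ← Matrix.trace_sum]
    congr 2
    calc _ = ∑ a, (B k).conjTranspose * ((A a).conjTranspose * A a) * B l := by
          refine Finset.sum_congr rfl fun a _ => ?_
          simp only [Matrix.conjTranspose_mul, Matrix.mul_assoc]
      _ = _ := by rw [← Finset.sum_mul, ← Finset.mul_sum, hA, mul_one]
  have htrA : (krausGram A).trace = 1 := by
    simp only [krausGram, Matrix.trace, Matrix.diag, Matrix.of_apply, ← Finset.mul_sum]
    change _ * ∑ k, ((A k).conjTranspose * A k).trace = 1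
    rw [← Matrix.trace_sum, hA, Matrix.trace_one, inv_mul_cancel₀]
    exact Nat.cast_ne_zero.mpr Fintype.card_ne_zero
  have htr : (krausGram fun q : κ × κ' => A q.1 * B q.2).trace = 1 := by
    rw [← htrA, ← hR]
    simp [Matrix.trace, partialTraceRight, Fintype.sum_prod_type]
  rw [krausMap_comp, mapEntropy_krausMap, mapEntropy_krausMap, mapEntropy_krausMap]
  have := vonNeumannEntropy_le_add_partialTrace (posSemidef_krausGram _) htr
  rwa [hR, hL] at this

end Kraus

end

end QuantumMap

theorem mainTheorem4 {ι : Type*} [Fintype ι] [DecidableEq ι]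
    (Φ Ψ : Matrix ι ι ℂ →CP Matrix ι ι ℂ)
    (hΦ : QuantumMap.IsBistochastic Φ.toLinearMap)
    (hΨ : QuantumMap.IsBistochastic Ψ.toLinearMap) :
    max (QuantumMap.mapEntropy Φ.toLinearMap) (QuantumMap.mapEntropy Ψ.toLinearMap) ≤
        QuantumMap.mapEntropy (Φ.toLinearMap ∘ₗ Ψ.toLinearMap) ∧
      QuantumMap.mapEntropy (Φ.toLinearMap ∘ₗ Ψ.toLinearMap) ≤
        QuantumMap.mapEntropy Φ.toLinearMap + QuantumMap.mapEntropy Ψ.toLinearMap := by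
  obtain ⟨A, hA⟩ := QuantumMap.exists_eq_krausMap Φ
  obtain ⟨B, hB⟩ := QuantumMap.exists_eq_krausMap Ψ
  rw [hA] at hΦ ⊢
  rw [hB] at hΨ ⊢
  have hA1 := QuantumMap.sum_mul_conjTranspose_self_of_unital hΦ.unit_preserving
  have hA2 := QuantumMap.sum_conjTranspose_mul_self_of_trace_preserving hΦ.trace_preserving
  have hB1 := QuantumMap.sum_mul_conjTranspose_self_of_unital hΨ.unit_preserving
  have hB2 := QuantumMap.sum_conjTranspose_mul_self_of_trace_preserving hΨ.trace_preserving
  exact ⟨max_le (QuantumMap.mapEntropy_le_krausMap_comp A hB1 hB2)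
    (QuantumMap.mapEntropy_le_comp_krausMap B hA1 hA2),
    QuantumMap.mapEntropy_comp_krausMap_le hA2 hB1⟩
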